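/- Let $n\in\mathbb N$ and let $\Omega\subseteq\mathbb R^n$ be nonempty, open and bounded. All sets and functions are Borel. For a Borel set $E\subseteq\mathbb R^n$ let $|E|$ be its Lebesgue measure and $$\operatorname{Per}(E)=\sup\Big\{\int_E\operatorname{div}\varphi\,dx\;;\;\varphi\in C_c^\infty(\mathbb R^n,\mathbb R^n),\ |\varphi|\le 1\Big\}\in[0,\infty]$$ its perimeter in $\mathbb R^n$. For $u\in L^1(\mathbb R^n)$ let $$|Du|(\mathbb R^n)=\sup\Big\{\int_{\mathbb R^n}u\operatorname{div}\varphi\,dx\;;\;\varphi\in C_c^\infty(\mathbb R^n,\mathbb R^n),\ |\varphi|\le 1\Big\}\in[0,\infty]$$ be its total variation in $\mathbb R^n$. Let $BV(\Omega)$ denote the space of all $u\in L^1(\mathbb R^n)$ with $|Du|(\mathbb R^n)<\infty$ and $u=0$ a.e. on $\mathbb R^n\setminus\Omega$. (If $\Omega$ has Lipschitz boundary, extension by zero identifies this space with the usual space of functions of bounded variation on $\Omega$.) Put $$H_1=\inf\Big\{\frac{\operatorname{Per}(E)}{|E|}\;;\;E\subseteq\Omega,\ |E|>0\Big\},\qquad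 \Lambda_1=\inf\Big\{\frac{|Du|(\mathbb R^n)}{\|u\|_1}\;;\;u\in BV(\Omega)\setminus\{0\}\Big\}.$$ A set $E\subseteq\Omega$ with $|E|>0$ and $\operatorname{Per}(E)/|E|=H_1$ is called a Cheeger set of $\Omega$; a function $u\in BV(\Omega)\setminus\{0\}$ with $|Du|(\mathbb R^n)/\|u\|_1=\Lambda_1$ is called a first eigenfunction of the $1$-Laplace operator. Then: 1. $H_1=\Lambda_1$. 2. A (possibly sign-changing) function $u\in BV(\Omega)\setminus\{0\}$ is a first eigenfunction if and only if for almost every $t\in\mathbb R$ the set $$E_t=\begin{cases}\{x\in\Omega\;;\;u(x)>t\}&\text{for }t>0,\\ \{x\in\Omega\;;\;u(x)<t\}&\text{for }t<0,\end{cases}$$ if it has positive measure, is a Cheeger set of $\Omega$. 3. The first eigenfunction is unique up to scalar multiples (there is a first eigenfunction $u$ such that every first eigenfunction equals $c\,u$ a.e. for some $c\in\mathbb R$) if and only if the Cheeger set is unique (there is a Cheeger set $C$ of $\Omega$ such that every Cheeger set $D$ of $\Omega$ satisfies $|D\triangle C|=0$). -/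

import Mathlib

open MeasureTheory Set
open scoped ContDiff

namespace OneLaplace

/-- The divergence of a vector field on `ℝⁿ`. -/
noncomputable def divergence {n : ℕ}
    (φ : EuclideanSpace ℝ (Fin n) → EuclideanSpace ℝ (Fin n))
    (x : EuclideanSpace ℝ (Fin n)) : ℝ :=
  ∑ i : Fin n, (fderiv ℝ φ x (EuclideanSpace.single i 1)) i

/-- The admissible test fields: `φ ∈ C_c^∞(ℝⁿ, ℝⁿ)` with `|φ| ≤ 1` (Euclidean norm). -/
def IsTestField {n : ℕ} (φ : EuclideanSpace ℝ (Fin n) → EuclideanSpace ℝ (Fin n)) : Prop :=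
  ContDiff ℝ ∞ φ ∧ HasCompactSupport φ ∧ ∀ x, ‖φ x‖ ≤ 1

/-- The distributional perimeter in `ℝⁿ`, `Per(E) = sup ∫_E div φ`, with values in `[0, ∞]`.
Since `φ = 0` is admissible the supremum is nonnegative, so `ENNReal.ofReal` loses nothing. -/
noncomputable def perimeter {n : ℕ} (E : Set (EuclideanSpace ℝ (Fin n))) : ENNReal :=
  ⨆ (φ : EuclideanSpace ℝ (Fin n) → EuclideanSpace ℝ (Fin n)) (_ : IsTestField φ),
    ENNReal.ofReal (∫ x in E, divergence φ x)

/-- The total variation `|Du|(ℝⁿ) = sup ∫ u div φ` of an integrable function `u`,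
with values in `[0, ∞]`. -/
noncomputable def totalVariation {n : ℕ} (u : EuclideanSpace ℝ (Fin n) → ℝ) : ENNReal :=
  ⨆ (φ : EuclideanSpace ℝ (Fin n) → EuclideanSpace ℝ (Fin n)) (_ : IsTestField φ),
    ENNReal.ofReal (∫ x, u x * divergence φ x)

/-- (Borel representatives of) functions `u ∈ BV(ℝⁿ)` with `u = 0` a.e. on `ℝⁿ \ Ω`. -/
structure MemBV {n : ℕ} (Ω : Set (EuclideanSpace ℝ (Fin n)))
    (u : EuclideanSpace ℝ (Fin n) → ℝ) : Prop where
  measurable : Measurable u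
  integrable : Integrable u
  totalVariation_lt_top : totalVariation u < ⊤
  ae_eq_zero : ∀ᵐ x, x ∉ Ω → u x = 0

/-- The Cheeger constant `H₁ = inf Per(E) / |E|` over the Borel sets `E ⊆ Ω` with `|E| > 0`. -/
noncomputable def cheegerConstant {n : ℕ} (Ω : Set (EuclideanSpace ℝ (Fin n))) : ENNReal :=
  ⨅ (E : Set (EuclideanSpace ℝ (Fin n))) (_ : MeasurableSet E ∧ E ⊆ Ω ∧ volume E ≠ 0),
    perimeter E / volume E

/-- `E` is a Cheeger set of `Ω`. -/
def IsCheegerSet {n : ℕ} (Ω E : Set (EuclideanSpace ℝ (Fin n))) : Prop :=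
  (MeasurableSet E ∧ E ⊆ Ω ∧ volume E ≠ 0) ∧ perimeter E / volume E = cheegerConstant Ω

/-- `Λ₁ = inf |Du|(ℝⁿ) / ‖u‖₁` over `BV(Ω) \ {0}`. -/
noncomputable def lambdaOne {n : ℕ} (Ω : Set (EuclideanSpace ℝ (Fin n))) : ENNReal :=
  ⨅ (u : EuclideanSpace ℝ (Fin n) → ℝ) (_ : MemBV Ω u ∧ ¬ u =ᵐ[volume] 0),
    totalVariation u / eLpNorm u 1 volume

/-- `u` is a minimizer for `Λ₁`, that is, a first eigenfunction of the 1-Laplace operator. -/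
def IsFirstEigenfunction {n : ℕ} (Ω : Set (EuclideanSpace ℝ (Fin n)))
    (u : EuclideanSpace ℝ (Fin n) → ℝ) : Prop :=
  (MemBV Ω u ∧ ¬ u =ᵐ[volume] 0) ∧ totalVariation u / eLpNorm u 1 volume = lambdaOne Ω

/-- The level set `E_t`: `{u > t}` for `t > 0` and `{u < t}` for `t < 0`, as subsets of `Ω`
(`t = 0` is irrelevant). -/
noncomputable def levelSet {n : ℕ} (Ω : Set (EuclideanSpace ℝ (Fin n)))
    (u : EuclideanSpace ℝ (Fin n) → ℝ) (t : ℝ) : Set (EuclideanSpace ℝ (Fin n)) :=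
  if 0 < t then {x ∈ Ω | t < u x} else if t < 0 then {x ∈ Ω | u x < t} else ∅

end OneLaplace

/-!
The proof rests on the coarea formula `|Du|(ℝⁿ) = ∫ Per(E_t) dt` together with Cavalieri's principle
`‖u‖₁ = ∫ |E_t| dt`, both with the signed level sets `E_t` of `levelSet`. Since every level set
satisfies `Per(E_t) ≥ H₁ |E_t|`, integrating over `t` gives `|Du|(ℝⁿ) ≥ H₁ ‖u‖₁`, hence `Λ₁ ≥ H₁`;
indicators of sets give the reverse inequality. Equality for a given `u` forces equality for almost
every level, and conversely, which is the level set criterion `isFirstEigenfunction_iff_levelSet`.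

For the uniqueness statements, a first eigenfunction always has a nonnull level set, so a Cheeger
set exists as soon as a first eigenfunction does, and conversely the indicator of a Cheeger set is
a first eigenfunction (`H₁` is finite because of smooth bumps in `Ω`). If all nonnull level sets of
`v` agree with `C`, then `v` is a multiple of the indicator of `C`, by integrating its layers
(`ae_eq_const_mul_indicator`). No existence result for minimizers is needed.

The sign conventions are packed into `layer s t`, which satisfies `s = ∫ layer s t dt`; the
function `layer (u ·) t` is, up to sign, the indicator of `E_t`. The lower half of the coarea
formula is then Fubini's theorem. The upper half is a duality argument. For test fields `φ i` and
weights `w i ≥ 0` on the levels with `∑ i, w i ≤ 1` one shows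
`∑ i, ∫ w i t * (∫ layer (u x) t * div (φ i) x dx) dt ≤ |Du|(ℝⁿ)`. For smooth `u` and `w i` the left
side is the pairing of `u` with the single test field `∑ i, w i (u x) • φ i x`
(`sum_integral_primitive_le_of_contDiff`); the general case follows by mollifying first `u`, which
does not increase the total variation, and then the weights. Choosing the weights so as to select,
at each level, the best of finitely many test fields from a countable family sufficient to compute
perimeters, and letting their number grow, yields `∫ Per(E_t) dt ≤ |Du|(ℝⁿ)`.
-/

open Filter Topology

namespace OneLaplace

variable {n : ℕ}

/-! ### Test fields and total variation -/

lemma IsTestField.zero : IsTestField (0 : EuclideanSpace ℝ (Fin n) → EuclideanSpace ℝ (Fin n)) :=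
  ⟨contDiff_const, HasCompactSupport.zero, fun x => by simp⟩

lemma IsTestField.neg {φ : EuclideanSpace ℝ (Fin n) → EuclideanSpace ℝ (Fin n)}
    (hφ : IsTestField φ) : IsTestField (-φ) :=
  ⟨hφ.1.neg, hφ.2.1.neg, fun x => by simpa using hφ.2.2 x⟩

lemma IsTestField.comp_add_right {φ : EuclideanSpace ℝ (Fin n) → EuclideanSpace ℝ (Fin n)}
    (hφ : IsTestField φ) (y : EuclideanSpace ℝ (Fin n)) : IsTestField (fun x => φ (x + y)) :=
  ⟨hφ.1.comp (contDiff_id.add contDiff_const), hφ.2.1.comp_homeomorph (Homeomorph.addRight y),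
    fun x => hφ.2.2 (x + y)⟩

lemma divergence_neg (φ : EuclideanSpace ℝ (Fin n) → EuclideanSpace ℝ (Fin n)) :
    divergence (-φ) = -divergence φ := by
  ext x
  simp [divergence, fderiv_neg]

lemma divergence_comp_add_right (φ : EuclideanSpace ℝ (Fin n) → EuclideanSpace ℝ (Fin n))
    (x y : EuclideanSpace ℝ (Fin n)) :
    divergence (fun z => φ (z + y)) x = divergence φ (x + y) := by
  simp [divergence, fderiv_comp_add_right]

lemma IsTestField.continuous_divergence
    {φ : EuclideanSpace ℝ (Fin n) → EuclideanSpace ℝ (Fin n)} (hφ : IsTestField φ) :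
    Continuous (divergence φ) := by
  have h : Continuous (fderiv ℝ φ) := hφ.1.continuous_fderiv (by simp)
  unfold divergence
  fun_prop

lemma IsTestField.hasCompactSupport_divergence
    {φ : EuclideanSpace ℝ (Fin n) → EuclideanSpace ℝ (Fin n)} (hφ : IsTestField φ) :
    HasCompactSupport (divergence φ) := by
  refine (hφ.2.1.fderiv ℝ).mono fun x hx => ?_
  contrapose! hx
  simp only [Function.mem_support, not_not] at hx ⊢
  simp [divergence, hx]

lemma IsTestField.integrable_divergence
    {φ : EuclideanSpace ℝ (Fin n) → EuclideanSpace ℝ (Fin n)} (hφ : IsTestField φ) :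
    Integrable (divergence φ) :=
  hφ.continuous_divergence.integrable_of_hasCompactSupport hφ.hasCompactSupport_divergence

lemma IsTestField.exists_norm_divergence_le
    {φ : EuclideanSpace ℝ (Fin n) → EuclideanSpace ℝ (Fin n)} (hφ : IsTestField φ) :
    ∃ M, ∀ x, ‖divergence φ x‖ ≤ M :=
  hφ.hasCompactSupport_divergence.exists_bound_of_continuous hφ.continuous_divergence

/-- Integration by parts against a test field. -/
lemma IsTestField.integral_mul_divergence
    {φ : EuclideanSpace ℝ (Fin n) → EuclideanSpace ℝ (Fin n)} (hφ : IsTestField φ)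
    {f : EuclideanSpace ℝ (Fin n) → ℝ} (hf : ContDiff ℝ 1 f) :
    ∫ x, f x * divergence φ x = -∫ x, fderiv ℝ f x (φ x) := by
  have hφd : Differentiable ℝ φ := hφ.1.differentiable (by simp)
  have hφc : Continuous (fderiv ℝ φ) := hφ.1.continuous_fderiv (by simp)
  have hfc : Continuous (fderiv ℝ f) := hf.continuous_fderiv (by simp)
  have hf0 : Continuous f := hf.continuous
  have hφ0 : Continuous φ := hφ.1.continuous
  have hcomp (i : Fin n) (x v) :
      fderiv ℝ (fun x => φ x i) x v = (fderiv ℝ φ x v) i := by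
    have := ((EuclideanSpace.proj (𝕜 := ℝ) i).hasFDerivAt.comp x (hφd x).hasFDerivAt).fderiv
    have h2 : ((EuclideanSpace.proj (𝕜 := ℝ) i) ∘ φ) = fun x => φ x i := rfl
    rw [h2] at this
    rw [this]; rfl
  have hs1 (i : Fin n) : HasCompactSupport (fun x => φ x i) :=
    hφ.2.1.mono fun x hx => by
      contrapose! hx
      simp only [Function.mem_support, not_not] at hx ⊢
      simp [hx]
  have hs2 (i : Fin n) :
      HasCompactSupport (fun x => (fderiv ℝ φ x (EuclideanSpace.single i 1)) i) :=
    (hφ.2.1.fderiv ℝ).mono fun x hx => by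
      contrapose! hx
      simp only [Function.mem_support, not_not] at hx ⊢
      simp [hx]
  have hI1 (i : Fin n) :
      Integrable fun x => f x * (fderiv ℝ φ x (EuclideanSpace.single i 1)) i :=
    Continuous.integrable_of_hasCompactSupport (by fun_prop) ((hs2 i).mul_left)
  have hI2 (i : Fin n) :
      Integrable fun x => fderiv ℝ f x (EuclideanSpace.single i 1) * φ x i :=
    Continuous.integrable_of_hasCompactSupport (by fun_prop) ((hs1 i).mul_left)
  have hI3 (i : Fin n) : Integrable fun x => f x * φ x i :=
    Continuous.integrable_of_hasCompactSupport (by fun_prop) ((hs1 i).mul_left)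
  have hexp (x) : fderiv ℝ f x (φ x) =
      ∑ i, fderiv ℝ f x (EuclideanSpace.single i 1) * φ x i := by
    conv_lhs => rw [← (EuclideanSpace.basisFun (Fin n) ℝ).sum_repr (φ x)]
    simp [map_sum, mul_comm]
  simp only [divergence, Finset.mul_sum, hexp]
  rw [integral_finsetSum _ fun i _ => hI1 i, integral_finsetSum _ fun i _ => hI2 i,
    ← Finset.sum_neg_distrib]
  refine Finset.sum_congr rfl fun i _ => ?_
  have := integral_mul_fderiv_eq_neg_fderiv_mul_of_integrable
    (μ := (volume : Measure (EuclideanSpace ℝ (Fin n)))) (f := f) (g := fun x => φ x i)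
    (v := EuclideanSpace.single i 1) (hI2 i) (by simpa only [hcomp] using hI1 i) (hI3 i)
    (fun x _ => (hf.differentiable (by simp)) x) (fun x _ => by fun_prop)
  simpa only [hcomp] using this

lemma IsTestField.ofReal_le_totalVariation
    {φ : EuclideanSpace ℝ (Fin n) → EuclideanSpace ℝ (Fin n)} (hφ : IsTestField φ)
    (u : EuclideanSpace ℝ (Fin n) → ℝ) :
    ENNReal.ofReal (∫ x, u x * divergence φ x) ≤ totalVariation u :=
  le_iSup₂ (f := fun φ (_ : IsTestField φ) => ENNReal.ofReal (∫ x, u x * divergence φ x)) φ hφ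

lemma IsTestField.integral_le_totalVariation
    {φ : EuclideanSpace ℝ (Fin n) → EuclideanSpace ℝ (Fin n)} (hφ : IsTestField φ)
    {u : EuclideanSpace ℝ (Fin n) → ℝ} (hu : totalVariation u ≠ ⊤) :
    ∫ x, u x * divergence φ x ≤ (totalVariation u).toReal :=
  (ENNReal.ofReal_le_iff_le_toReal hu).1 (hφ.ofReal_le_totalVariation u)

lemma totalVariation_congr_ae {u v : EuclideanSpace ℝ (Fin n) → ℝ} (h : u =ᵐ[volume] v) :
    totalVariation u = totalVariation v := by
  unfold totalVariation
  refine iSup_congr fun φ => iSup_congr fun _ => ?_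
  congr 1
  refine integral_congr_ae ?_
  filter_upwards [h] with x hx
  rw [hx]

lemma totalVariation_neg (u : EuclideanSpace ℝ (Fin n) → ℝ) :
    totalVariation (-u) = totalVariation u := by
  have key (w : EuclideanSpace ℝ (Fin n) → ℝ) : totalVariation (-w) ≤ totalVariation w := by
    refine iSup₂_le fun φ hφ => ?_
    refine le_trans (le_of_eq ?_) (hφ.neg.ofReal_le_totalVariation w)
    simp [divergence_neg]
  exact le_antisymm (key u) (by simpa using key (-u))

/-- The perimeter is the total variation of the indicator function. -/
lemma totalVariation_indicator_one {E : Set (EuclideanSpace ℝ (Fin n))} (hE : MeasurableSet E) :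
    totalVariation (E.indicator 1) = perimeter E := by
  unfold totalVariation perimeter
  refine iSup_congr fun φ => iSup_congr fun _ => ?_
  rw [← integral_indicator hE]
  congr 2 with x
  by_cases hx : x ∈ E <;> simp [hx]

lemma totalVariation_zero : totalVariation (0 : EuclideanSpace ℝ (Fin n) → ℝ) = 0 := by
  simp [totalVariation]

lemma totalVariation_lt_top_of_contDiff {f : EuclideanSpace ℝ (Fin n) → ℝ}
    (hf : ContDiff ℝ 1 f) (hfs : HasCompactSupport f) : totalVariation f < ⊤ := by
  have hI : Integrable (fun x => ‖fderiv ℝ f x‖) :=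
    Continuous.integrable_of_hasCompactSupport (hf.continuous_fderiv (by simp)).norm
      (hfs.fderiv ℝ).norm
  refine lt_of_le_of_lt (iSup₂_le fun φ hφ => ENNReal.ofReal_le_ofReal ?_)
    (ENNReal.ofReal_lt_top (r := ∫ x, ‖fderiv ℝ f x‖))
  rw [hφ.integral_mul_divergence hf]
  refine (le_abs_self _).trans ?_
  rw [abs_neg]
  refine norm_integral_le_of_norm_le (f := fun x => fderiv ℝ f x (φ x)) hI (ae_of_all _ fun x => ?_)
  refine ((fderiv ℝ f x).le_opNorm (φ x)).trans ?_
  exact mul_le_of_le_one_right (norm_nonneg _) (hφ.2.2 x)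

/-- Countably many test fields suffice to compute the total variation of every function bounded
by `1`: the divergences form a separable subset of `L¹`. -/
lemma exists_seq_testField (n : ℕ) :
    ∃ Φ : ℕ → EuclideanSpace ℝ (Fin n) → EuclideanSpace ℝ (Fin n), (∀ k, IsTestField (Φ k)) ∧
      ∀ f : EuclideanSpace ℝ (Fin n) → ℝ, Measurable f → (∀ x, ‖f x‖ ≤ 1) →
        totalVariation f = ⨆ k, ENNReal.ofReal (∫ x, f x * divergence (Φ k) x) := by
  have : Fact ((1 : ENNReal) ≠ ⊤) := ⟨ENNReal.one_ne_top⟩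
  let T := {φ : EuclideanSpace ℝ (Fin n) → EuclideanSpace ℝ (Fin n) // IsTestField φ}
  have : Nonempty T := ⟨⟨0, IsTestField.zero⟩⟩
  let D : T → Lp ℝ 1 (volume : Measure (EuclideanSpace ℝ (Fin n))) := fun φ =>
    φ.2.integrable_divergence.toL1 _
  let S : ℕ → range D := TopologicalSpace.denseSeq (range D)
  choose Φ hΦ using fun k => (S k).2
  refine ⟨fun k => (Φ k).1, fun k => (Φ k).2, fun f hf hf1 => ?_⟩
  have hint (φ : T) : Integrable (fun x => f x * divergence φ.1 x) :=
    φ.2.integrable_divergence.bdd_mul hf.aestronglyMeasurable (ae_of_all _ hf1)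
  refine le_antisymm (iSup₂_le fun φ hφ => ?_)
    (iSup_le fun k => (Φ k).2.ofReal_le_totalVariation f)
  refine ENNReal.le_of_forall_pos_le_add fun ε hε _ => ?_
  -- The error is controlled in `L¹` because `f` is bounded by `1`.
  obtain ⟨k, hk⟩ : ∃ k, dist (D ⟨φ, hφ⟩) (D (Φ k)) < ε := by
    have hd := TopologicalSpace.denseRange_denseSeq (range D)
    obtain ⟨k, hk⟩ := hd.exists_dist_lt ⟨D ⟨φ, hφ⟩, mem_range_self _⟩ (ε := ε) (by exact_mod_cast hε)
    refine ⟨k, ?_⟩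
    rw [hΦ k]
    exact hk
  have h1 : ∫ x, f x * divergence φ x ≤ (∫ x, f x * divergence (Φ k).1 x) + ε := by
    have h2 : dist (D ⟨φ, hφ⟩) (D (Φ k)) =
        ∫ x, ‖divergence φ x - divergence (Φ k).1 x‖ := by
      rw [L1.dist_eq_integral_dist]
      refine integral_congr_ae ?_
      filter_upwards [hφ.integrable_divergence.coeFn_toL1,
        (Φ k).2.integrable_divergence.coeFn_toL1] with x hx hx'
      simp only [D]
      rw [hx, hx', dist_eq_norm]
    have h3 : (∫ x, f x * divergence φ x) - (∫ x, f x * divergence (Φ k).1 x) ≤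
        ∫ x, ‖divergence φ x - divergence (Φ k).1 x‖ := by
      rw [← integral_sub (hint ⟨φ, hφ⟩) (hint (Φ k))]
      refine integral_mono ((hint ⟨φ, hφ⟩).sub (hint (Φ k)))
        (hφ.integrable_divergence.sub (Φ k).2.integrable_divergence).norm fun x => ?_
      simp only
      rw [← mul_sub]
      refine (le_abs_self _).trans ?_
      rw [abs_mul]
      exact mul_le_of_le_one_left (abs_nonneg _) (hf1 x)
    linarith [h2 ▸ hk]
  calc ENNReal.ofReal (∫ x, f x * divergence φ x)
      ≤ ENNReal.ofReal ((∫ x, f x * divergence (Φ k).1 x) + ε) := ENNReal.ofReal_le_ofReal h1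
    _ ≤ ENNReal.ofReal (∫ x, f x * divergence (Φ k).1 x) + ENNReal.ofReal ε :=
        ENNReal.ofReal_add_le
    _ ≤ _ := by
        rw [ENNReal.ofReal_coe_nnreal]
        gcongr
        exact le_iSup (fun k => ENNReal.ofReal (∫ x, f x * divergence (Φ k).1 x)) k

/-! ### Layers and level sets -/

/-- The signed layer function of a real number `s`: as a function of `t` it is `1` on `(0, s)` if
`s > 0`, is `-1` on `(s, 0)` if `s < 0`, and vanishes elsewhere, so that
`s = ∫ layer s t dt`. -/
noncomputable def layer (s t : ℝ) : ℝ := (Ioo 0 s).indicator 1 t - (Ioo s 0).indicator 1 t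

lemma measurable_layer : Measurable (Function.uncurry layer) := by
  have h : Function.uncurry layer = {p : ℝ × ℝ | 0 < p.2 ∧ p.2 < p.1}.indicator 1 -
      {p : ℝ × ℝ | p.1 < p.2 ∧ p.2 < 0}.indicator 1 := by
    ext ⟨s, t⟩
    simp [Function.uncurry, layer, indicator]
  rw [h]
  refine (measurable_one.indicator ?_).sub (measurable_one.indicator ?_)
  · exact (measurableSet_lt measurable_const measurable_snd).inter
      (measurableSet_lt measurable_snd measurable_fst)
  · exact (measurableSet_lt measurable_fst measurable_snd).inter
      (measurableSet_lt measurable_snd measurable_const)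

lemma layer_of_nonneg {s : ℝ} (hs : 0 ≤ s) : layer s = (Ioo 0 s).indicator 1 := by
  ext t
  simp [layer, Ioo_eq_empty_of_le hs]

lemma layer_of_nonpos {s : ℝ} (hs : s ≤ 0) : layer s = -(Ioo s 0).indicator 1 := by
  ext t
  simp [layer, Ioo_eq_empty_of_le hs]

lemma norm_layer_le (s t : ℝ) : ‖layer s t‖ ≤ 1 := by
  rcases le_total 0 s with hs | hs
  · rw [layer_of_nonneg hs]
    by_cases h : t ∈ Ioo 0 s <;> simp [h]
  · rw [layer_of_nonpos hs]
    by_cases h : t ∈ Ioo s 0 <;> simp [h]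

lemma lintegral_enorm_layer (s : ℝ) : ∫⁻ t, ‖layer s t‖ₑ = ‖s‖ₑ := by
  rcases le_total 0 s with hs | hs
  · simp_rw [layer_of_nonneg hs, enorm_indicator_eq_indicator_enorm]
    rw [lintegral_indicator measurableSet_Ioo]
    simp [Real.enorm_eq_ofReal_abs, abs_of_nonneg hs]
  · simp_rw [layer_of_nonpos hs, Pi.neg_apply, enorm_neg, enorm_indicator_eq_indicator_enorm]
    rw [lintegral_indicator measurableSet_Ioo]
    simp [Real.enorm_eq_ofReal_abs, abs_of_nonpos hs]

lemma integral_layer_mul (w : ℝ → ℝ) (s : ℝ) : ∫ t, layer s t * w t = ∫ t in 0..s, w t := by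
  rcases le_total 0 s with hs | hs
  · have h : (fun t => layer s t * w t) = (Ioo 0 s).indicator w := by
      ext t
      by_cases h : t ∈ Ioo 0 s <;> simp [layer_of_nonneg hs, h]
    rw [h, integral_indicator measurableSet_Ioo, intervalIntegral.integral_of_le hs,
      integral_Ioc_eq_integral_Ioo]
  · have h : (fun t => layer s t * w t) = fun t => -(Ioo s 0).indicator w t := by
      ext t
      by_cases h : t ∈ Ioo s 0 <;> simp [layer_of_nonpos hs, h]
    rw [h, integral_neg, integral_indicator measurableSet_Ioo, intervalIntegral.integral_of_ge hs,
      integral_Ioc_eq_integral_Ioo]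

lemma layer_of_pos_right (s : ℝ) {t : ℝ} (ht : 0 < t) : layer s t = (Ioi t).indicator 1 s := by
  simp [layer, indicator, ht, ht.le.not_gt]

lemma layer_of_neg_right (s : ℝ) {t : ℝ} (ht : t < 0) : layer s t = -(Iio t).indicator 1 s := by
  simp [layer, indicator, ht, ht.le.not_gt]

lemma layer_zero_right (s : ℝ) : layer s 0 = 0 := by
  simp [layer]

section LevelSets

variable {Ω : Set (EuclideanSpace ℝ (Fin n))} {u : EuclideanSpace ℝ (Fin n) → ℝ}

lemma measurableSet_levelSet (hΩ : MeasurableSet Ω) (hu : Measurable u) (t : ℝ) :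
    MeasurableSet (levelSet Ω u t) := by
  unfold levelSet
  split_ifs
  · exact hΩ.inter (measurableSet_lt measurable_const hu)
  · exact hΩ.inter (measurableSet_lt hu measurable_const)
  · exact MeasurableSet.empty

lemma levelSet_subset (Ω : Set (EuclideanSpace ℝ (Fin n))) (u : EuclideanSpace ℝ (Fin n) → ℝ)
    (t : ℝ) : levelSet Ω u t ⊆ Ω := by
  unfold levelSet
  split_ifs
  · exact fun x hx => hx.1
  · exact fun x hx => hx.1
  · exact empty_subset _

lemma layer_ae_eq_of_pos (h0 : ∀ᵐ x, x ∉ Ω → u x = 0) {t : ℝ} (ht : 0 < t) :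
    (fun x => layer (u x) t) =ᵐ[volume] (levelSet Ω u t).indicator 1 := by
  filter_upwards [h0] with x hx
  rw [layer_of_pos_right _ ht]
  by_cases hxΩ : x ∈ Ω
  · simp [levelSet, ht, indicator, hxΩ]
  · simp [levelSet, ht, indicator, hxΩ, hx hxΩ, ht.le]

lemma layer_ae_eq_of_neg (h0 : ∀ᵐ x, x ∉ Ω → u x = 0) {t : ℝ} (ht : t < 0) :
    (fun x => layer (u x) t) =ᵐ[volume] -(levelSet Ω u t).indicator 1 := by
  filter_upwards [h0] with x hx
  rw [layer_of_neg_right _ ht]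
  by_cases hxΩ : x ∈ Ω
  · simp [levelSet, ht, ht.le.not_gt, indicator, hxΩ]
  · simp [levelSet, ht, ht.le.not_gt, indicator, hxΩ, hx hxΩ]

/-- The slice of the layers of `u` at level `t` is `±` the indicator of `levelSet Ω u t` almost
everywhere; the sign is irrelevant because test fields can be negated. -/
lemma totalVariation_layer (hΩ : MeasurableSet Ω) (hu : Measurable u)
    (h0 : ∀ᵐ x, x ∉ Ω → u x = 0) (t : ℝ) :
    totalVariation (fun x => layer (u x) t) = perimeter (levelSet Ω u t) := by
  rw [← totalVariation_indicator_one (measurableSet_levelSet hΩ hu t)]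
  rcases lt_trichotomy t 0 with ht | rfl | ht
  · rw [totalVariation_congr_ae (layer_ae_eq_of_neg h0 ht), totalVariation_neg]
  · simp [layer_zero_right, levelSet, totalVariation]
  · rw [totalVariation_congr_ae (layer_ae_eq_of_pos h0 ht)]

lemma lintegral_enorm_layer_comp (hΩ : MeasurableSet Ω) (hu : Measurable u)
    (h0 : ∀ᵐ x, x ∉ Ω → u x = 0) (t : ℝ) :
    ∫⁻ x, ‖layer (u x) t‖ₑ = volume (levelSet Ω u t) := by
  rw [← lintegral_indicator_one (measurableSet_levelSet hΩ hu t)]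
  rcases lt_trichotomy t 0 with ht | rfl | ht
  · refine lintegral_congr_ae ?_
    filter_upwards [layer_ae_eq_of_neg h0 ht] with x hx
    rw [hx, Pi.neg_apply, enorm_neg, enorm_indicator_eq_indicator_enorm]
    simp [indicator]
  · simp [layer_zero_right, levelSet]
  · refine lintegral_congr_ae ?_
    filter_upwards [layer_ae_eq_of_pos h0 ht] with x hx
    rw [hx, enorm_indicator_eq_indicator_enorm]
    simp [indicator]

lemma measurable_uncurry_layer_comp (hu : Measurable u) :
    Measurable (Function.uncurry fun t x => layer (u x) t) :=
  measurable_layer.comp ((hu.comp measurable_snd).prodMk measurable_fst)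

lemma measurable_layer_comp (hu : Measurable u) (t : ℝ) : Measurable fun x => layer (u x) t :=
  (measurable_uncurry_layer_comp hu).comp measurable_prodMk_left

/-- Cavalieri's principle for the level sets. -/
lemma lintegral_volume_levelSet (hΩ : MeasurableSet Ω) (hu : Measurable u)
    (h0 : ∀ᵐ x, x ∉ Ω → u x = 0) :
    ∫⁻ t, volume (levelSet Ω u t) = eLpNorm u 1 volume := by
  simp_rw [← lintegral_enorm_layer_comp hΩ hu h0]
  rw [lintegral_lintegral_swap (f := fun t x => ‖layer (u x) t‖ₑ)
    (measurable_uncurry_layer_comp hu).enorm.aemeasurable, eLpNorm_one_eq_lintegral_enorm]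
  simp_rw [lintegral_enorm_layer]

lemma integrable_uncurry_layer (hu : Measurable u) (hui : Integrable u) :
    Integrable (Function.uncurry fun t x => layer (u x) t) (volume.prod volume) := by
  refine ⟨(measurable_uncurry_layer_comp hu).aestronglyMeasurable, ?_⟩
  rw [hasFiniteIntegral_iff_enorm, lintegral_prod_symm' _ (measurable_uncurry_layer_comp hu).enorm]
  simp only [Function.uncurry_apply_pair, lintegral_enorm_layer]
  exact hui.2

lemma integrable_uncurry_layer_mul_divergence (hu : Measurable u) (hui : Integrable u)
    {φ : EuclideanSpace ℝ (Fin n) → EuclideanSpace ℝ (Fin n)} (hφ : IsTestField φ) :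
    Integrable (Function.uncurry fun t x => layer (u x) t * divergence φ x)
      (volume.prod volume) := by
  obtain ⟨M, hM⟩ := hφ.exists_norm_divergence_le
  have h1 : AEStronglyMeasurable (fun p : ℝ × EuclideanSpace ℝ (Fin n) => divergence φ p.2)
      (volume.prod volume) :=
    (hφ.continuous_divergence.comp continuous_snd).aestronglyMeasurable
  have h2 := (integrable_uncurry_layer hu hui).mul_bdd h1 (ae_of_all _ fun p => hM p.2)
  simpa only [Function.uncurry_def] using h2

lemma integrable_integral_layer_mul_divergence (hu : Measurable u) (hui : Integrable u)
    {φ : EuclideanSpace ℝ (Fin n) → EuclideanSpace ℝ (Fin n)} (hφ : IsTestField φ) :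
    Integrable fun t => ∫ x, layer (u x) t * divergence φ x :=
  (integrable_uncurry_layer_mul_divergence hu hui hφ).integral_prod_left

lemma measurable_integral_layer_mul_divergence (hu : Measurable u)
    {φ : EuclideanSpace ℝ (Fin n) → EuclideanSpace ℝ (Fin n)} (hφ : IsTestField φ) :
    Measurable fun t => ∫ x, layer (u x) t * divergence φ x := by
  refine (StronglyMeasurable.integral_prod_right
    (f := fun t x => layer (u x) t * divergence φ x) ?_).measurable
  exact ((measurable_uncurry_layer_comp hu).mul
    (hφ.continuous_divergence.measurable.comp measurable_snd)).stronglyMeasurable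

/-- Fubini's theorem for the layers, weighted by a bounded function of the level. -/
lemma integral_mul_integral_layer (hu : Measurable u) (hui : Integrable u)
    {φ : EuclideanSpace ℝ (Fin n) → EuclideanSpace ℝ (Fin n)} (hφ : IsTestField φ)
    {w : ℝ → ℝ} (hw : Measurable w) (hw1 : ∀ t, ‖w t‖ ≤ 1) :
    ∫ t, w t * ∫ x, layer (u x) t * divergence φ x =
      ∫ x, (∫ t in 0..u x, w t) * divergence φ x := by
  have hI : Integrable (Function.uncurry fun t x => w t * (layer (u x) t * divergence φ x))
      (volume.prod volume) := by
    have h1 : AEStronglyMeasurable (fun p : ℝ × EuclideanSpace ℝ (Fin n) => w p.1)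
        (volume.prod volume) := (hw.comp measurable_fst).aestronglyMeasurable
    have h2 := (integrable_uncurry_layer_mul_divergence hu hui hφ).bdd_mul h1
      (ae_of_all _ fun p => hw1 p.1)
    simpa only [Function.uncurry_def] using h2
  simp_rw [← integral_const_mul]
  rw [integral_integral_swap hI]
  refine integral_congr_ae (ae_of_all _ fun x => ?_)
  simp only
  rw [← integral_layer_mul, ← integral_mul_const]
  congr 1 with t
  ring

/-- The lower half of the coarea formula. -/
lemma totalVariation_le_lintegral_perimeter (hΩ : MeasurableSet Ω) (hu : Measurable u)
    (hui : Integrable u) (h0 : ∀ᵐ x, x ∉ Ω → u x = 0) :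
    totalVariation u ≤ ∫⁻ t, perimeter (levelSet Ω u t) := by
  refine iSup₂_le fun φ hφ => ?_
  have h := integral_mul_integral_layer hu hui hφ (w := fun _ => 1) measurable_const (by simp)
  simp only [one_mul, intervalIntegral.integral_const, sub_zero, smul_eq_mul, mul_one] at h
  rw [← h]
  calc ENNReal.ofReal (∫ t, ∫ x, layer (u x) t * divergence φ x)
      ≤ ∫⁻ t, ENNReal.ofReal (∫ x, layer (u x) t * divergence φ x) := by
        refine ENNReal.ofReal_le_of_le_toReal ?_
        have hI := integrable_integral_layer_mul_divergence hu hui hφ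
        rw [integral_eq_lintegral_pos_part_sub_lintegral_neg_part hI]
        linarith [ENNReal.toReal_nonneg
          (a := ∫⁻ t, ENNReal.ofReal (-∫ x, layer (u x) t * divergence φ x))]
    _ ≤ _ := by
        refine lintegral_mono fun t => ?_
        rw [← totalVariation_layer hΩ hu h0]
        exact hφ.ofReal_le_totalVariation _

end LevelSets

/-! ### Mollification and weighted pairings -/

/-- Smooth bumps at the origin whose supports shrink at a controlled ratio of radii. -/
lemma exists_seq_contDiffBump (E : Type*) [NormedAddCommGroup E] [NormedSpace ℝ E] :
    ∃ ρ : ℕ → ContDiffBump (0 : E), Tendsto (fun k => (ρ k).rOut) atTop (𝓝 0) ∧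
      ∀ k, (ρ k).rOut ≤ 2 * (ρ k).rIn := by
  refine ⟨fun k => ⟨1 / ((k : ℝ) + 1), 2 * (1 / ((k : ℝ) + 1)), by positivity, ?_⟩, ?_,
    fun k => le_rfl⟩
  · have : 0 < 1 / ((k : ℝ) + 1) := by positivity
    linarith
  · simpa using (tendsto_one_div_add_atTop_nhds_zero_nat (𝕜 := ℝ)).const_mul 2

/-- Mollification does not increase the total variation: it averages translates of the function,
and translates of test fields are test fields. -/
lemma totalVariation_convolution_le (ρ : ContDiffBump (0 : EuclideanSpace ℝ (Fin n)))
    {u : EuclideanSpace ℝ (Fin n) → ℝ} (hui : Integrable u) :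
    totalVariation (convolution (ρ.normed volume) u (ContinuousLinearMap.lsmul ℝ ℝ) volume) ≤
      totalVariation u := by
  by_cases hT : totalVariation u = ⊤
  · simp [hT]
  refine iSup₂_le fun φ hφ => ENNReal.ofReal_le_of_le_toReal ?_
  obtain ⟨M, hM⟩ := hφ.exists_norm_divergence_le
  have hρi : Integrable (ρ.normed volume) :=
    ρ.continuous_normed.integrable_of_hasCompactSupport ρ.hasCompactSupport_normed
  have hI : Integrable (Function.uncurry fun x y => ρ.normed volume y * u (x - y) *
      divergence φ x) (volume.prod volume) := by
    have h1 := hρi.convolution_integrand (ContinuousLinearMap.lsmul ℝ ℝ) hui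
    have h2 : AEStronglyMeasurable (fun p : EuclideanSpace ℝ (Fin n) × EuclideanSpace ℝ (Fin n) =>
        divergence φ p.1) (volume.prod volume) :=
      (hφ.continuous_divergence.comp continuous_fst).aestronglyMeasurable
    have h3 := h1.mul_bdd h2 (ae_of_all _ fun p => hM p.1)
    simpa only [Function.uncurry_def, ContinuousLinearMap.lsmul_apply, smul_eq_mul] using h3
  have hinner (y : EuclideanSpace ℝ (Fin n)) :
      ∫ x, ρ.normed volume y * u (x - y) * divergence φ x =
        ρ.normed volume y * ∫ x, u x * divergence (fun z => φ (z + y)) x := by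
    rw [← integral_const_mul, ← integral_add_right_eq_self _ y]
    congr 1 with x
    rw [divergence_comp_add_right, add_sub_cancel_right, mul_assoc]
  have hJ := hI.integral_prod_right
  simp only [Function.uncurry_apply_pair, hinner] at hJ
  calc ∫ x, convolution (ρ.normed volume) u (ContinuousLinearMap.lsmul ℝ ℝ) volume x *
        divergence φ x
      = ∫ x, ∫ y, ρ.normed volume y * u (x - y) * divergence φ x := by
        congr 1 with x
        rw [convolution_def, ← integral_mul_const]
        rfl
    _ = ∫ y, ρ.normed volume y * ∫ x, u x * divergence (fun z => φ (z + y)) x := by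
        rw [integral_integral_swap hI]
        simp_rw [hinner]
    _ ≤ ∫ y, ρ.normed volume y * (totalVariation u).toReal :=
        integral_mono hJ (hρi.mul_const _) fun y =>
          mul_le_mul_of_nonneg_left ((hφ.comp_add_right y).integral_le_totalVariation hT)
            (ρ.nonneg_normed y)
    _ = (totalVariation u).toReal := by
        rw [integral_mul_const, ρ.integral_normed, one_mul]

lemma hasDerivAt_integral_of_continuous {w : ℝ → ℝ} (hw : Continuous w) (s : ℝ) :
    HasDerivAt (fun s => ∫ t in 0..s, w t) (w s) s :=
  intervalIntegral.integral_hasDerivAt_right (hw.intervalIntegrable _ _)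
    (hw.stronglyMeasurableAtFilter _ _) hw.continuousAt

lemma contDiff_integral_of_continuous {w : ℝ → ℝ} (hw : Continuous w) :
    ContDiff ℝ 1 (fun s => ∫ t in 0..s, w t) := by
  rw [contDiff_one_iff_deriv]
  refine ⟨fun s => (hasDerivAt_integral_of_continuous hw s).differentiableAt, ?_⟩
  convert hw using 1
  ext s
  exact (hasDerivAt_integral_of_continuous hw s).deriv

/-- For a smooth function `v`, smooth weights `w i ≥ 0` of total at most `1` and test fields `φ i`,
the field `∑ i, w i (v x) • φ i x` is again a test field. Two integrations by parts turn its
pairing with `v` into the sum of the pairings of the `φ i` with the primitives `T i ∘ v`,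
where `T i' = w i`. -/
lemma sum_integral_primitive_le_of_contDiff {v : EuclideanSpace ℝ (Fin n) → ℝ}
    (hv : ContDiff ℝ ∞ v) (hT : totalVariation v ≠ ⊤) {ι : Type*} (s : Finset ι)
    {w : ι → ℝ → ℝ} (hw : ∀ i, ContDiff ℝ ∞ (w i)) (hw0 : ∀ i t, 0 ≤ w i t)
    (hw1 : ∀ t, ∑ i ∈ s, w i t ≤ 1)
    {φ : ι → EuclideanSpace ℝ (Fin n) → EuclideanSpace ℝ (Fin n)} (hφ : ∀ i, IsTestField (φ i)) :
    ∑ i ∈ s, ∫ x, (∫ t in 0..v x, w i t) * divergence (φ i) x ≤ (totalVariation v).toReal := by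
  have hsupp (i : ι) : HasCompactSupport fun x => w i (v x) • φ i x :=
    (hφ i).2.1.mono (Function.support_smul_subset_right (fun x => w i (v x)) (φ i))
  have hψ : IsTestField fun x => ∑ i ∈ s, w i (v x) • φ i x := by
    refine ⟨ContDiff.sum fun i _ => ((hw i).comp hv).smul (hφ i).1, ?_, fun x => ?_⟩
    · classical
      induction s using Finset.induction_on with
      | empty =>
        simp only [Finset.sum_empty]
        exact HasCompactSupport.zero
      | insert a s ha ih =>
        simp_rw [Finset.sum_insert ha]
        refine (hsupp a).add (ih fun t => le_trans ?_ (hw1 t))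
        rw [Finset.sum_insert ha]
        exact le_add_of_nonneg_left (hw0 a t)
    · refine (norm_sum_le _ _).trans ((Finset.sum_le_sum fun i _ => ?_).trans (hw1 (v x)))
      rw [norm_smul, Real.norm_of_nonneg (hw0 i _)]
      exact mul_le_of_le_one_right (hw0 i _) ((hφ i).2.2 x)
  have hv1 : ContDiff ℝ 1 v := hv.of_le (by simp)
  have hvc : Continuous (fderiv ℝ v) := hv1.continuous_fderiv (by simp)
  have hv0 : Continuous v := hv.continuous
  have hI (i : ι) : Integrable fun x => fderiv ℝ v x (w i (v x) • φ i x) := by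
    have hc1 : Continuous (w i) := (hw i).continuous
    have hc2 : Continuous (φ i) := (hφ i).1.continuous
    refine Continuous.integrable_of_hasCompactSupport (by fun_prop) ((hsupp i).mono fun x hx => ?_)
    contrapose! hx
    simp only [Function.mem_support, not_not] at hx ⊢
    rw [hx, map_zero]
  refine le_trans (le_of_eq ?_) (hψ.integral_le_totalVariation hT)
  rw [hψ.integral_mul_divergence hv1]
  simp_rw [map_sum]
  rw [integral_finsetSum _ fun i _ => hI i, ← Finset.sum_neg_distrib]
  refine Finset.sum_congr rfl fun i _ => ?_
  refine ((hφ i).integral_mul_divergence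
    ((contDiff_integral_of_continuous (hw i).continuous).comp hv1)).trans ?_
  congr 2 with x
  have h1 : HasFDerivAt (fun x => ∫ t in 0..v x, w i t) (w i (v x) • fderiv ℝ v x) x :=
    (hasDerivAt_integral_of_continuous (hw i).continuous (v x)).comp_hasFDerivAt x
      (hv1.differentiable (by simp) x).hasFDerivAt
  have h2 : fderiv ℝ ((fun s => ∫ t in 0..s, w i t) ∘ v) x = w i (v x) • fderiv ℝ v x := h1.fderiv
  rw [h2]
  simp

lemma norm_integral_le_integral_norm_univ {w : ℝ → ℝ} (hw : Integrable w) (s : ℝ) :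
    ‖∫ t in 0..s, w t‖ ≤ ∫ t, ‖w t‖ := by
  refine (intervalIntegral.norm_integral_le_integral_norm_uIoc).trans ?_
  exact setIntegral_le_integral hw.norm (ae_of_all _ fun t => norm_nonneg _)

/-- The inequality of `sum_integral_primitive_le_of_contDiff` for integrable functions. The
primitives of compactly supported weights are bounded and continuous, so they pass to the limit
along a mollification. -/
lemma sum_integral_primitive_le {u : EuclideanSpace ℝ (Fin n) → ℝ}
    (hui : Integrable u) (hT : totalVariation u ≠ ⊤) {ι : Type*} (s : Finset ι)
    {w : ι → ℝ → ℝ} (hw : ∀ i, ContDiff ℝ ∞ (w i)) (hws : ∀ i, HasCompactSupport (w i))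
    (hw0 : ∀ i t, 0 ≤ w i t) (hw1 : ∀ t, ∑ i ∈ s, w i t ≤ 1)
    {φ : ι → EuclideanSpace ℝ (Fin n) → EuclideanSpace ℝ (Fin n)} (hφ : ∀ i, IsTestField (φ i)) :
    ∑ i ∈ s, ∫ x, (∫ t in 0..u x, w i t) * divergence (φ i) x ≤ (totalVariation u).toReal := by
  obtain ⟨ρ, hρ, hρ2⟩ := exists_seq_contDiffBump (EuclideanSpace ℝ (Fin n))
  let v : ℕ → EuclideanSpace ℝ (Fin n) → ℝ := fun k =>
    convolution ((ρ k).normed volume) u (ContinuousLinearMap.lsmul ℝ ℝ) volume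
  have hv (k : ℕ) : ContDiff ℝ ∞ (v k) :=
    (ρ k).hasCompactSupport_normed.contDiff_convolution_left _ (ρ k).contDiff_normed
      hui.locallyIntegrable
  have hvT (k : ℕ) : totalVariation (v k) ≤ totalVariation u := totalVariation_convolution_le _ hui
  have hlim : ∀ᵐ x, Tendsto (fun k => v k x) atTop (𝓝 (u x)) :=
    ContDiffBump.ae_convolution_tendsto_right_of_locallyIntegrable hρ (Eventually.of_forall hρ2)
      hui.locallyIntegrable
  have hwi (i : ι) : Integrable (w i) :=
    (hw i).continuous.integrable_of_hasCompactSupport (hws i)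
  have hTc (i : ι) : Continuous fun s => ∫ t in 0..s, w i t :=
    (contDiff_integral_of_continuous (hw i).continuous).continuous
  refine le_of_tendsto' (f := fun k => ∑ i ∈ s, ∫ x, (∫ t in 0..v k x, w i t) *
    divergence (φ i) x) (x := atTop) ?_ fun k => ?_
  · refine tendsto_finsetSum _ fun i _ => ?_
    refine tendsto_integral_of_dominated_convergence
      (fun x => (∫ t, ‖w i t‖) * ‖divergence (φ i) x‖) (fun k => ?_)
      ((hφ i).integrable_divergence.norm.const_mul _) (fun k => ae_of_all _ fun x => ?_) ?_
    · exact (((hTc i).comp (hv k).continuous).mul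
        (hφ i).continuous_divergence).aestronglyMeasurable
    · rw [norm_mul]
      exact mul_le_mul_of_nonneg_right (norm_integral_le_integral_norm_univ (hwi i) _)
        (norm_nonneg _)
    · filter_upwards [hlim] with x hx
      exact (((hTc i).tendsto _).comp hx).mul_const _
  · exact (sum_integral_primitive_le_of_contDiff (hv k) ((hvT k).trans_lt hT.lt_top).ne s hw hw0 hw1
      hφ).trans (ENNReal.toReal_mono hT (hvT k))

/-- The same inequality, read level by level, for merely measurable weights. -/
lemma sum_integral_mul_layer_le {u : EuclideanSpace ℝ (Fin n) → ℝ} (hu : Measurable u)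
    (hui : Integrable u) (hT : totalVariation u ≠ ⊤) {ι : Type*} (s : Finset ι)
    {w : ι → ℝ → ℝ} (hw : ∀ i, Measurable (w i)) (hws : ∀ i, HasCompactSupport (w i))
    (hw0 : ∀ i t, 0 ≤ w i t) (hwle : ∀ i t, w i t ≤ 1) (hw1 : ∀ t, ∑ i ∈ s, w i t ≤ 1)
    {φ : ι → EuclideanSpace ℝ (Fin n) → EuclideanSpace ℝ (Fin n)} (hφ : ∀ i, IsTestField (φ i)) :
    ∑ i ∈ s, ∫ t, w i t * ∫ x, layer (u x) t * divergence (φ i) x ≤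
      (totalVariation u).toReal := by
  have hnorm (i : ι) (t : ℝ) : ‖w i t‖ ≤ 1 := by
    rw [Real.norm_of_nonneg (hw0 i t)]
    exact hwle i t
  have hwi (i : ι) : Integrable (w i) := by
    have h1 : IntegrableOn (w i) (tsupport (w i)) :=
      Measure.integrableOn_of_bounded (M := 1) (hws i).isCompact.measure_lt_top.ne
        (hw i).aestronglyMeasurable (ae_of_all _ (hnorm i))
    exact (integrableOn_iff_integrable_of_support_subset (subset_tsupport _)).1 h1
  obtain ⟨ρ, hρ, hρ2⟩ := exists_seq_contDiffBump ℝ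
  have hρi (k : ℕ) : Integrable ((ρ k).normed volume) :=
    (ρ k).continuous_normed.integrable_of_hasCompactSupport (ρ k).hasCompactSupport_normed
  let W : ℕ → ι → ℝ → ℝ := fun k i =>
    convolution ((ρ k).normed volume) (w i) (ContinuousLinearMap.lsmul ℝ ℝ) volume
  have hWdef (k i t) : W k i t = ∫ y, (ρ k).normed volume y * w i (t - y) := rfl
  have hWint (k i t) : Integrable fun y => (ρ k).normed volume y * w i (t - y) :=
    (hρi k).mul_bdd ((hw i).comp (measurable_const.sub measurable_id)).aestronglyMeasurable
      (ae_of_all _ fun y => hnorm i (t - y))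
  have hW (k i) : ContDiff ℝ ∞ (W k i) :=
    (ρ k).hasCompactSupport_normed.contDiff_convolution_left _ (ρ k).contDiff_normed
      (hwi i).locallyIntegrable
  have hWs (k i) : HasCompactSupport (W k i) :=
    HasCompactSupport.convolution _ (ρ k).hasCompactSupport_normed (hws i)
  have hW0 (k i t) : 0 ≤ W k i t :=
    integral_nonneg fun y => mul_nonneg ((ρ k).nonneg_normed y) (hw0 i _)
  have hWle (k i t) : W k i t ≤ 1 := by
    rw [hWdef, ← (ρ k).integral_normed (μ := volume)]
    exact integral_mono (hWint k i t) (hρi k) fun y =>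
      mul_le_of_le_one_right ((ρ k).nonneg_normed y) (hwle i _)
  have hWnorm (k i t) : ‖W k i t‖ ≤ 1 := by
    rw [Real.norm_of_nonneg (hW0 k i t)]
    exact hWle k i t
  have hW1 (k t) : ∑ i ∈ s, W k i t ≤ 1 := by
    simp_rw [hWdef]
    rw [← integral_finsetSum _ fun i _ => hWint k i t, ← (ρ k).integral_normed (μ := volume)]
    refine integral_mono (integrable_finsetSum _ fun i _ => hWint k i t) (hρi k) fun y => ?_
    simp only
    rw [← Finset.mul_sum]
    exact mul_le_of_le_one_right ((ρ k).nonneg_normed y) (hw1 _)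
  refine le_of_tendsto' (f := fun k => ∑ i ∈ s, ∫ t, W k i t *
    ∫ x, layer (u x) t * divergence (φ i) x) (x := atTop) ?_ fun k => ?_
  · refine tendsto_finsetSum _ fun i _ => ?_
    have hG := integrable_integral_layer_mul_divergence hu hui (hφ i)
    refine tendsto_integral_of_dominated_convergence
      (fun t => ‖∫ x, layer (u x) t * divergence (φ i) x‖) (fun k => ?_) hG.norm
      (fun k => ae_of_all _ fun t => ?_) ?_
    · exact (hW k i).continuous.aestronglyMeasurable.mul hG.aestronglyMeasurable
    · rw [norm_mul]
      exact mul_le_of_le_one_left (norm_nonneg _) (hWnorm k i t)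
    · have hlim : ∀ᵐ t, Tendsto (fun k => W k i t) atTop (𝓝 (w i t)) :=
        ContDiffBump.ae_convolution_tendsto_right_of_locallyIntegrable hρ
          (Eventually.of_forall hρ2) (hwi i).locallyIntegrable
      filter_upwards [hlim] with t ht
      exact ht.mul_const _
  · simp_rw [fun i => integral_mul_integral_layer hu hui (hφ i) (hW k i).continuous.measurable
      (hWnorm k i)]
    exact sum_integral_primitive_le hui hT s (hW k) (hWs k) (hW0 k) (hW1 k) hφ

/-! ### The coarea formula -/

variable {Ω : Set (EuclideanSpace ℝ (Fin n))} {u : EuclideanSpace ℝ (Fin n) → ℝ}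

/-- One sequence of test fields computes the perimeters of all level sets of `u`. This gives the
measurability of the perimeter in the level and the monotone approximation behind the upper half of
the coarea formula. -/
lemma exists_seq_perimeter_levelSet (hΩ : MeasurableSet Ω) (hu : Measurable u)
    (h0 : ∀ᵐ x, x ∉ Ω → u x = 0) :
    ∃ Φ : ℕ → EuclideanSpace ℝ (Fin n) → EuclideanSpace ℝ (Fin n), (∀ k, IsTestField (Φ k)) ∧
      ∀ t, perimeter (levelSet Ω u t) =
        ⨆ k, ENNReal.ofReal (∫ x, layer (u x) t * divergence (Φ k) x) := by
  obtain ⟨Φ, hΦ, h⟩ := exists_seq_testField n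
  refine ⟨Φ, hΦ, fun t => ?_⟩
  rw [← totalVariation_layer hΩ hu h0,
    h _ (measurable_layer_comp hu t) fun x => norm_layer_le (u x) t]

lemma measurable_perimeter_levelSet (hΩ : MeasurableSet Ω) (hu : Measurable u)
    (h0 : ∀ᵐ x, x ∉ Ω → u x = 0) : Measurable fun t => perimeter (levelSet Ω u t) := by
  obtain ⟨Φ, hΦ, h⟩ := exists_seq_perimeter_levelSet hΩ hu h0
  simp_rw [h]
  exact Measurable.iSup fun k => (measurable_integral_layer_mul_divergence hu (hΦ k)).ennreal_ofReal

lemma measurable_volume_levelSet (hΩ : MeasurableSet Ω) (hu : Measurable u)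
    (h0 : ∀ᵐ x, x ∉ Ω → u x = 0) : Measurable fun t => volume (levelSet Ω u t) := by
  simp_rw [← lintegral_enorm_layer_comp hΩ hu h0]
  exact (measurable_uncurry_layer_comp hu).enorm.lintegral_prod_right

/-- The upper half of the coarea formula. The perimeter of `levelSet Ω u t` is the supremum of
countably many pairings with test fields; selecting, for each level `t`, the best of the first `N`
fields produces weights to which `sum_integral_mul_layer_le` applies. -/
lemma lintegral_perimeter_le_totalVariation (hΩ : MeasurableSet Ω) (hu : Measurable u)
    (hui : Integrable u) (h0 : ∀ᵐ x, x ∉ Ω → u x = 0) :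
    ∫⁻ t, perimeter (levelSet Ω u t) ≤ totalVariation u := by
  by_cases hT : totalVariation u = ⊤
  · simp [hT]
  obtain ⟨Φ, hΦ, hper⟩ := exists_seq_perimeter_levelSet hΩ hu h0
  let G : ℕ → ℝ → ℝ := fun k t => ∫ x, layer (u x) t * divergence (Φ k) x
  have hG (k : ℕ) : Measurable (G k) := measurable_integral_layer_mul_divergence hu (hΦ k)
  have hGi (k : ℕ) : Integrable (G k) := integrable_integral_layer_mul_divergence hu hui (hΦ k)
  -- Truncating the levels to `[-N, N]` makes the weights compactly supported.
  let F : ℕ → ℝ → ENNReal := fun N =>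
    (Icc (-(N : ℝ)) N).indicator fun t => ⨆ (k : ℕ) (_ : k ≤ N), ENNReal.ofReal (G k t)
  have hF (N : ℕ) : Measurable (F N) :=
    (Measurable.iSup fun k => Measurable.iSup_Prop _ (hG k).ennreal_ofReal).indicator
      measurableSet_Icc
  have hFmono : Monotone F := by
    intro N N' hN t
    have hN' : (N : ℝ) ≤ N' := by exact_mod_cast hN
    by_cases ht : t ∈ Icc (-(N : ℝ)) N
    · have ht' : t ∈ Icc (-(N' : ℝ)) N' := ⟨by linarith [ht.1], by linarith [ht.2]⟩
      simp only [F, indicator_of_mem ht, indicator_of_mem ht']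
      exact iSup_mono fun k => iSup_mono' fun hk => ⟨hk.trans hN, le_rfl⟩
    · simp [F, ht]
  have hsup (t : ℝ) : perimeter (levelSet Ω u t) ≤ ⨆ N, F N t := by
    rw [hper]
    refine iSup_le fun k => ?_
    obtain ⟨m, hm⟩ := exists_nat_ge |t|
    refine le_trans ?_ (le_iSup (fun N => F N t) (max k m))
    have ht : t ∈ Icc (-((max k m : ℕ) : ℝ)) (max k m : ℕ) :=
      abs_le.1 (hm.trans (by exact_mod_cast le_max_right k m))
    simp only [F, indicator_of_mem ht]
    exact le_iSup₂ (f := fun i (_ : i ≤ max k m) => ENNReal.ofReal (G i t)) k (le_max_left k m)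
  refine (lintegral_mono hsup).trans ?_
  rw [lintegral_iSup hF hFmono]
  refine iSup_le fun N => ?_
  -- `B j` collects the levels at which the field `Φ j` is the best among the first ones;
  -- `disjointed` breaks the ties.
  let B : ℕ → Set ℝ := fun j =>
    {t | j ≤ N ∧ t ∈ Icc (-(N : ℝ)) N ∧ 0 ≤ G j t ∧ ∀ i, i ≤ N → G i t ≤ G j t}
  have hB (j : ℕ) : MeasurableSet (B j) := by
    have h1 : B j = {t | j ≤ N} ∩ (Icc (-(N : ℝ)) N ∩ ({t | 0 ≤ G j t} ∩
        ⋂ i, ⋂ (_ : i ≤ N), {t | G i t ≤ G j t})) := by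
      ext t
      simp [B]
    rw [h1]
    exact (MeasurableSet.const _).inter (measurableSet_Icc.inter
      ((measurableSet_le measurable_const (hG j)).inter (MeasurableSet.iInter fun i =>
        MeasurableSet.iInter fun _ => measurableSet_le (hG i) (hG j))))
  let w : ℕ → ℝ → ℝ := fun j => (disjointed B j).indicator 1
  have hsub (j : ℕ) {t : ℝ} (ht : t ∈ disjointed B j) : t ∈ B j := disjointed_subset B j ht
  have hw (j : ℕ) : Measurable (w j) :=
    measurable_one.indicator (MeasurableSet.disjointed hB j)
  have hw0 (j : ℕ) (t : ℝ) : 0 ≤ w j t := indicator_nonneg (fun _ _ => zero_le_one) t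
  have hwle (j : ℕ) (t : ℝ) : w j t ≤ 1 := indicator_le_self' (fun _ _ => zero_le_one) t
  have hws (j : ℕ) : HasCompactSupport (w j) := by
    refine HasCompactSupport.intro (isCompact_Icc (a := -(N : ℝ)) (b := N)) fun t ht => ?_
    exact indicator_of_notMem (fun h => ht (hsub j h).2.1) _
  have hw1 (t : ℝ) : ∑ j ∈ Finset.range (N + 1), w j t ≤ 1 := by
    have h1 := Finset.indicator_biUnion (Finset.range (N + 1)) (disjointed B)
      (f := (1 : ℝ → ℝ)) fun i _ j _ hij => disjoint_disjointed B hij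
    simp only [w]
    rw [← congrFun h1 t]
    exact indicator_le_self' (fun _ _ => zero_le_one) t
  have hterm (j : ℕ) (t : ℝ) : 0 ≤ w j t * G j t := by
    by_cases ht : t ∈ disjointed B j
    · exact mul_nonneg (hw0 j t) (hsub j ht).2.2.1
    · simp [w, ht]
  have hFle (t : ℝ) : F N t ≤ ENNReal.ofReal (∑ j ∈ Finset.range (N + 1), w j t * G j t) := by
    by_cases ht : t ∈ Icc (-(N : ℝ)) N
    swap
    · simp [F, ht]
    simp only [F, indicator_of_mem ht]
    refine iSup₂_le fun k hk => ?_
    rcases le_or_gt (G k t) 0 with hk0 | hk0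
    · simp [ENNReal.ofReal_of_nonpos hk0]
    obtain ⟨m, hm, hmax⟩ := Finset.exists_max_image (Finset.range (N + 1)) (fun i => G i t)
      ⟨k, Finset.mem_range.2 (by omega)⟩
    have hmB : t ∈ ⋃ j, B j := mem_iUnion.2 ⟨m, by have := Finset.mem_range.1 hm; omega, ht,
      hk0.le.trans (hmax k (Finset.mem_range.2 (by omega))),
      fun i hi => hmax i (Finset.mem_range.2 (by omega))⟩
    rw [← iUnion_disjointed] at hmB
    obtain ⟨j, hj⟩ := mem_iUnion.1 hmB
    have hjB := hsub j hj
    refine ENNReal.ofReal_le_ofReal ?_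
    calc G k t ≤ G j t := hjB.2.2.2 k hk
      _ = w j t * G j t := by simp [w, hj]
      _ ≤ _ := Finset.single_le_sum (f := fun j => w j t * G j t) (fun i _ => hterm i t)
        (Finset.mem_range.2 (Nat.lt_succ_of_le hjB.1))
  have hwGi (j : ℕ) : Integrable fun t => w j t * G j t :=
    (hGi j).bdd_mul (hw j).aestronglyMeasurable (c := 1) (ae_of_all _ fun t => by
      rw [Real.norm_of_nonneg (hw0 j t)]
      exact hwle j t)
  refine (lintegral_mono hFle).trans ?_
  rw [← ofReal_integral_eq_lintegral_ofReal (integrable_finsetSum _ fun j _ => hwGi j)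
    (ae_of_all _ fun t => Finset.sum_nonneg fun j _ => hterm j t),
    integral_finsetSum _ fun j _ => hwGi j]
  exact ENNReal.ofReal_le_of_le_toReal
    (sum_integral_mul_layer_le hu hui hT (Finset.range (N + 1)) hw hws hw0 hwle hw1 hΦ)

/-- The coarea formula. -/
lemma totalVariation_eq_lintegral_perimeter (hΩ : MeasurableSet Ω) (hu : Measurable u)
    (hui : Integrable u) (h0 : ∀ᵐ x, x ∉ Ω → u x = 0) :
    totalVariation u = ∫⁻ t, perimeter (levelSet Ω u t) :=
  le_antisymm (totalVariation_le_lintegral_perimeter hΩ hu hui h0)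
    (lintegral_perimeter_le_totalVariation hΩ hu hui h0)

/-! ### The two variational problems -/

lemma cheegerConstant_le_div {E : Set (EuclideanSpace ℝ (Fin n))} (hE : MeasurableSet E)
    (hEΩ : E ⊆ Ω) (hE0 : volume E ≠ 0) : cheegerConstant Ω ≤ perimeter E / volume E :=
  iInf₂_le (f := fun E (_ : MeasurableSet E ∧ E ⊆ Ω ∧ volume E ≠ 0) => perimeter E / volume E) E
    ⟨hE, hEΩ, hE0⟩

lemma lambdaOne_le_div (hu : MemBV Ω u) (hu0 : ¬ u =ᵐ[volume] 0) :
    lambdaOne Ω ≤ totalVariation u / eLpNorm u 1 volume :=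
  iInf₂_le (f := fun u (_ : MemBV Ω u ∧ ¬ u =ᵐ[volume] 0) =>
    totalVariation u / eLpNorm u 1 volume) u ⟨hu, hu0⟩

lemma cheegerConstant_mul_volume_le {E : Set (EuclideanSpace ℝ (Fin n))}
    (hΩb : Bornology.IsBounded Ω) (hE : MeasurableSet E) (hEΩ : E ⊆ Ω) :
    cheegerConstant Ω * volume E ≤ perimeter E := by
  by_cases hE0 : volume E = 0
  · simp [hE0]
  · exact (ENNReal.le_div_iff_mul_le (Or.inl hE0)
      (Or.inl (hΩb.subset hEΩ).measure_lt_top.ne)).1 (cheegerConstant_le_div hE hEΩ hE0)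

lemma MemBV.eLpNorm_ne_zero (hu : MemBV Ω u) (hu0 : ¬ u =ᵐ[volume] 0) :
    eLpNorm u 1 volume ≠ 0 := by
  rwa [Ne, eLpNorm_eq_zero_iff hu.measurable.aestronglyMeasurable one_ne_zero]

lemma MemBV.eLpNorm_ne_top (hu : MemBV Ω u) : eLpNorm u 1 volume ≠ ⊤ :=
  (memLp_one_iff_integrable.2 hu.integrable).eLpNorm_ne_top

/-- Integrating `cheegerConstant Ω * |E_t| ≤ Per(E_t)` over the levels. -/
lemma MemBV.cheegerConstant_mul_eLpNorm_le (hΩo : IsOpen Ω) (hΩb : Bornology.IsBounded Ω)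
    (hu : MemBV Ω u) : cheegerConstant Ω * eLpNorm u 1 volume ≤ totalVariation u := by
  rw [totalVariation_eq_lintegral_perimeter hΩo.measurableSet hu.measurable hu.integrable
    hu.ae_eq_zero, ← lintegral_volume_levelSet hΩo.measurableSet hu.measurable hu.ae_eq_zero,
    ← lintegral_const_mul _
      (measurable_volume_levelSet hΩo.measurableSet hu.measurable hu.ae_eq_zero)]
  exact lintegral_mono fun t => cheegerConstant_mul_volume_le hΩb
    (measurableSet_levelSet hΩo.measurableSet hu.measurable t) (levelSet_subset Ω u t)

lemma memBV_indicator_one {E : Set (EuclideanSpace ℝ (Fin n))} (hΩb : Bornology.IsBounded Ω)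
    (hE : MeasurableSet E) (hEΩ : E ⊆ Ω) (hper : perimeter E < ⊤) :
    MemBV Ω (E.indicator 1) where
  measurable := measurable_one.indicator hE
  integrable := (integrable_indicator_iff hE).2
    (integrableOn_const (hΩb.subset hEΩ).measure_lt_top.ne)
  totalVariation_lt_top := by rwa [totalVariation_indicator_one hE]
  ae_eq_zero := ae_of_all _ fun x hx => indicator_of_notMem (fun h => hx (hEΩ h)) _

lemma eLpNorm_indicator_one {E : Set (EuclideanSpace ℝ (Fin n))} (hE : MeasurableSet E) :
    eLpNorm (E.indicator (1 : EuclideanSpace ℝ (Fin n) → ℝ)) 1 volume = volume E := by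
  rw [eLpNorm_one_eq_lintegral_enorm]
  simp_rw [enorm_indicator_eq_indicator_enorm]
  rw [lintegral_indicator hE]
  simp

lemma not_indicator_one_ae_eq_zero {E : Set (EuclideanSpace ℝ (Fin n))} (hE0 : volume E ≠ 0) :
    ¬ E.indicator (1 : EuclideanSpace ℝ (Fin n) → ℝ) =ᵐ[volume] 0 := by
  rw [indicator_ae_eq_zero]
  simpa [Function.support_one] using hE0

/-- Sets of infinite perimeter are not competitors for `lambdaOne`, but their quotient is `⊤`. -/
lemma cheegerConstant_eq_lambdaOne (hΩo : IsOpen Ω) (hΩb : Bornology.IsBounded Ω) :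
    cheegerConstant Ω = lambdaOne Ω := by
  refine le_antisymm (le_iInf₂ fun u hu => ?_) (le_iInf₂ fun E hE => ?_)
  · exact (ENNReal.le_div_iff_mul_le (Or.inl (hu.1.eLpNorm_ne_zero hu.2))
      (Or.inl hu.1.eLpNorm_ne_top)).2 (hu.1.cheegerConstant_mul_eLpNorm_le hΩo hΩb)
  · obtain ⟨hE, hEΩ, hE0⟩ := hE
    rcases eq_top_or_lt_top (perimeter E) with hper | hper
    · rw [hper, ENNReal.top_div_of_ne_top (hΩb.subset hEΩ).measure_lt_top.ne]
      exact le_top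
    · have := lambdaOne_le_div (memBV_indicator_one hΩb hE hEΩ hper)
        (not_indicator_one_ae_eq_zero hE0)
      rwa [totalVariation_indicator_one hE, eLpNorm_indicator_one hE] at this

/-- A smooth bump supported in `Ω` is a competitor of finite total variation. -/
lemma lambdaOne_lt_top (hΩo : IsOpen Ω) (hΩne : Ω.Nonempty) : lambdaOne Ω < ⊤ := by
  obtain ⟨x₀, hx₀⟩ := hΩne
  obtain ⟨f, hfΩ, hfs, hf, -, hf1⟩ :=
    exists_contDiff_tsupport_subset (n := 1) (hΩo.mem_nhds hx₀)
  have hfc : Continuous f := hf.continuous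
  have hBV : MemBV Ω f :=
    { measurable := hfc.measurable
      integrable := hfc.integrable_of_hasCompactSupport hfs
      totalVariation_lt_top := totalVariation_lt_top_of_contDiff hf hfs
      ae_eq_zero := ae_of_all _ fun x hx => image_eq_zero_of_notMem_tsupport fun h => hx (hfΩ h) }
  have hf0 : ¬ f =ᵐ[volume] 0 := fun h => by
    have := congrFun (Continuous.ae_eq_iff_eq (μ := volume) hfc continuous_zero |>.1 h) x₀
    simp [hf1] at this
  exact (lambdaOne_le_div hBV hf0).trans_lt
    (ENNReal.div_lt_top hBV.totalVariation_lt_top.ne (hBV.eLpNorm_ne_zero hf0))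

lemma isFirstEigenfunction_iff_totalVariation_eq (hΩo : IsOpen Ω) (hΩb : Bornology.IsBounded Ω)
    (hu : MemBV Ω u) (hu0 : ¬ u =ᵐ[volume] 0) :
    IsFirstEigenfunction Ω u ↔
      totalVariation u = cheegerConstant Ω * eLpNorm u 1 volume := by
  rw [IsFirstEigenfunction, and_iff_right ⟨hu, hu0⟩, ← cheegerConstant_eq_lambdaOne hΩo hΩb,
    eq_comm, ENNReal.eq_div_iff (hu.eLpNorm_ne_zero hu0) hu.eLpNorm_ne_top, eq_comm, mul_comm]

lemma isCheegerSet_iff_perimeter_eq {E : Set (EuclideanSpace ℝ (Fin n))}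
    (hΩb : Bornology.IsBounded Ω) (hE : MeasurableSet E) (hEΩ : E ⊆ Ω) (hE0 : volume E ≠ 0) :
    IsCheegerSet Ω E ↔ perimeter E = cheegerConstant Ω * volume E := by
  rw [IsCheegerSet, and_iff_right ⟨hE, hEΩ, hE0⟩,
    eq_comm, ENNReal.eq_div_iff hE0 (hΩb.subset hEΩ).measure_lt_top.ne, eq_comm, mul_comm]

/-- Both sides say that the inequality `cheegerConstant Ω * |E_t| ≤ Per(E_t)` is an equality for
almost every level `t`; null level sets have zero perimeter. -/
lemma isFirstEigenfunction_iff_levelSet (hΩo : IsOpen Ω) (hΩb : Bornology.IsBounded Ω)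
    (hu : MemBV Ω u) (hu0 : ¬ u =ᵐ[volume] 0) :
    IsFirstEigenfunction Ω u ↔
      ∀ᵐ t : ℝ, volume (levelSet Ω u t) ≠ 0 → IsCheegerSet Ω (levelSet Ω u t) := by
  have hms := measurableSet_levelSet hΩo.measurableSet hu.measurable
  have hV := measurable_volume_levelSet hΩo.measurableSet hu.measurable hu.ae_eq_zero
  have hco := totalVariation_eq_lintegral_perimeter hΩo.measurableSet hu.measurable hu.integrable
    hu.ae_eq_zero
  rw [isFirstEigenfunction_iff_totalVariation_eq hΩo hΩb hu hu0,
    ← lintegral_volume_levelSet hΩo.measurableSet hu.measurable hu.ae_eq_zero,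
    ← lintegral_const_mul _ hV]
  constructor
  · intro h
    have hae := ae_eq_of_ae_le_of_lintegral_le
      (ae_of_all _ fun t => cheegerConstant_mul_volume_le hΩb (hms t) (levelSet_subset Ω u t))
      (h ▸ hu.totalVariation_lt_top.ne)
      (measurable_perimeter_levelSet hΩo.measurableSet hu.measurable hu.ae_eq_zero).aemeasurable
      (hco ▸ h.le)
    filter_upwards [hae] with t ht ht0
    exact (isCheegerSet_iff_perimeter_eq hΩb (hms t) (levelSet_subset Ω u t) ht0).2 ht.symm
  · intro h
    rw [hco]
    refine lintegral_congr_ae ?_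
    filter_upwards [h] with t ht
    by_cases ht0 : volume (levelSet Ω u t) = 0
    · rw [← totalVariation_indicator_one (hms t), ht0, mul_zero, totalVariation_congr_ae
        (indicator_meas_zero ht0), totalVariation_zero]
    · exact (isCheegerSet_iff_perimeter_eq hΩb (hms t) (levelSet_subset Ω u t) ht0).1 (ht ht0)

/-- The perimeter of a Cheeger set is finite since `cheegerConstant Ω` is, so that its indicator is
a function of bounded variation. -/
lemma IsCheegerSet.isFirstEigenfunction {C : Set (EuclideanSpace ℝ (Fin n))} (hΩo : IsOpen Ω)
    (hΩne : Ω.Nonempty) (hΩb : Bornology.IsBounded Ω) (hC : IsCheegerSet Ω C) :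
    IsFirstEigenfunction Ω (C.indicator 1) := by
  obtain ⟨hCm, hCΩ, hC0⟩ := hC.1
  have hper := (isCheegerSet_iff_perimeter_eq hΩb hCm hCΩ hC0).1 hC
  have hlt : perimeter C < ⊤ := by
    rw [hper, cheegerConstant_eq_lambdaOne hΩo hΩb]
    exact ENNReal.mul_lt_top (lambdaOne_lt_top hΩo hΩne) (hΩb.subset hCΩ).measure_lt_top
  rw [isFirstEigenfunction_iff_totalVariation_eq hΩo hΩb (memBV_indicator_one hΩb hCm hCΩ hlt)
    (not_indicator_one_ae_eq_zero hC0), totalVariation_indicator_one hCm,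
    eLpNorm_indicator_one hCm, hper]

/-- By Cavalieri's principle a nonzero function has nonnull level sets, and almost all of them are
Cheeger sets. -/
lemma IsFirstEigenfunction.exists_isCheegerSet (hΩo : IsOpen Ω) (hΩb : Bornology.IsBounded Ω)
    (hu : IsFirstEigenfunction Ω u) : ∃ C, IsCheegerSet Ω C := by
  have hae := (isFirstEigenfunction_iff_levelSet hΩo hΩb hu.1.1 hu.1.2).1 hu
  by_contra! hno
  refine hu.1.1.eLpNorm_ne_zero hu.1.2 ?_
  rw [← lintegral_volume_levelSet hΩo.measurableSet hu.1.1.measurable hu.1.1.ae_eq_zero,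
    lintegral_eq_zero_iff (measurable_volume_levelSet hΩo.measurableSet hu.1.1.measurable
      hu.1.1.ae_eq_zero)]
  filter_upwards [hae] with t ht
  by_contra ht0
  exact hno _ (ht ht0)

/-! ### Uniqueness -/

lemma volume_symmDiff_eq_zero_of_indicator {C D : Set (EuclideanSpace ℝ (Fin n))}
    (hC : volume C ≠ 0) (hD : volume D ≠ 0) {c d : ℝ}
    (hcu : C.indicator 1 =ᵐ[volume] fun x => c * u x)
    (hdu : D.indicator 1 =ᵐ[volume] fun x => d * u x) : volume (symmDiff D C) = 0 := by
  rw [measure_symmDiff_eq_zero_iff]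
  obtain ⟨y, hyC, hy, -⟩ := ((frequently_ae_mem_iff.2 hC).and_eventually (hcu.and hdu)).exists
  obtain ⟨x, hxD, hx, hx'⟩ := ((frequently_ae_mem_iff.2 hD).and_eventually (hcu.and hdu)).exists
  have hc0 : c ≠ 0 := by
    rintro rfl
    simp [hyC] at hy
  have hu0 : u x ≠ 0 := by
    intro h
    simp [hxD, h] at hx'
  have hxC : x ∈ C := by
    by_contra h
    rw [indicator_of_notMem h] at hx
    exact mul_ne_zero hc0 hu0 hx.symm
  rw [indicator_of_mem hxC] at hx
  rw [indicator_of_mem hxD] at hx'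
  have hcd : c = d := mul_right_cancel₀ hu0 (hx.symm.trans hx')
  filter_upwards [hcu, hdu] with z hz hz'
  rw [← hcd, ← hz] at hz'
  refine propext (show z ∈ D ↔ z ∈ C from ?_)
  by_cases h : z ∈ D <;> by_cases h' : z ∈ C <;> simp_all

/-- If almost every nonnull level set of `v` agrees with `C`, then each layer of `v` is a constant
multiple of the indicator of `C`; integrating the layers, so is `v`. -/
lemma ae_eq_const_mul_indicator {v : EuclideanSpace ℝ (Fin n) → ℝ} (hΩ : MeasurableSet Ω)
    (hv : Measurable v) (h0 : ∀ᵐ x, x ∉ Ω → v x = 0) {C : Set (EuclideanSpace ℝ (Fin n))}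
    (hC : MeasurableSet C)
    (h : ∀ᵐ t : ℝ, volume (levelSet Ω v t) ≠ 0 → levelSet Ω v t =ᵐ[volume] C) :
    ∃ c : ℝ, v =ᵐ[volume] fun x => c * C.indicator 1 x := by
  -- The layer of `v` at level `t` is `σ t` times the indicator of `C`.
  let σ : ℝ → ℝ := fun t =>
    if volume (levelSet Ω v t) = 0 then 0 else if 0 < t then 1 else -1
  have hσ : Measurable σ :=
    Measurable.ite (measurable_volume_levelSet hΩ hv h0 (measurableSet_singleton 0))
      measurable_const (Measurable.ite measurableSet_Ioi measurable_const measurable_const)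
  have hae : ∀ᵐ t : ℝ, ∀ᵐ x : EuclideanSpace ℝ (Fin n),
      layer (v x) t = σ t * C.indicator 1 x := by
    filter_upwards [h] with t ht
    by_cases ht0 : volume (levelSet Ω v t) = 0
    · have h1 : ∫⁻ x, ‖layer (v x) t‖ₑ = 0 := by rw [lintegral_enorm_layer_comp hΩ hv h0, ht0]
      rw [lintegral_eq_zero_iff (measurable_layer_comp hv t).enorm] at h1
      filter_upwards [h1] with x hx
      simpa [σ, ht0] using hx
    · have h1 : (levelSet Ω v t).indicator (1 : EuclideanSpace ℝ (Fin n) → ℝ) =ᵐ[volume]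
          C.indicator 1 := indicator_ae_eq_of_ae_eq_set (ht ht0)
      rcases lt_trichotomy t 0 with htn | rfl | htp
      · filter_upwards [layer_ae_eq_of_neg h0 htn, h1] with x hx hx'
        rw [hx, Pi.neg_apply, hx']
        simp [σ, ht0, htn.le.not_gt]
      · simp [levelSet] at ht0
      · filter_upwards [layer_ae_eq_of_pos h0 htp, h1] with x hx hx'
        rw [hx, hx']
        simp [σ, ht0, htp]
  rw [Measure.ae_ae_comm] at hae
  · refine ⟨∫ t, σ t, ?_⟩
    filter_upwards [hae] with x hx
    have h1 := integral_layer_mul (fun _ => 1) (v x)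
    simp only [mul_one, intervalIntegral.integral_const, sub_zero, smul_eq_mul] at h1
    rw [← integral_mul_const, ← h1]
    exact integral_congr_ae hx
  · exact measurableSet_eq_fun (measurable_uncurry_layer_comp hv)
      ((hσ.comp measurable_fst).mul ((measurable_one.indicator hC).comp measurable_snd))

lemma exists_unique_eigenfunction_iff (hΩo : IsOpen Ω) (hΩne : Ω.Nonempty)
    (hΩb : Bornology.IsBounded Ω) :
    (∃ u : EuclideanSpace ℝ (Fin n) → ℝ, IsFirstEigenfunction Ω u ∧
        ∀ v : EuclideanSpace ℝ (Fin n) → ℝ, IsFirstEigenfunction Ω v →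
          ∃ c : ℝ, v =ᵐ[volume] fun x => c * u x) ↔
      ∃ C : Set (EuclideanSpace ℝ (Fin n)), IsCheegerSet Ω C ∧
        ∀ D : Set (EuclideanSpace ℝ (Fin n)), IsCheegerSet Ω D → volume (symmDiff D C) = 0 := by
  constructor
  · rintro ⟨u, hu, huniq⟩
    obtain ⟨C, hC⟩ := hu.exists_isCheegerSet hΩo hΩb
    refine ⟨C, hC, fun D hD => ?_⟩
    obtain ⟨c, hc⟩ := huniq _ (hC.isFirstEigenfunction hΩo hΩne hΩb)
    obtain ⟨d, hd⟩ := huniq _ (hD.isFirstEigenfunction hΩo hΩne hΩb)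
    exact volume_symmDiff_eq_zero_of_indicator hC.1.2.2 hD.1.2.2 hc hd
  · rintro ⟨C, hC, huniq⟩
    refine ⟨C.indicator 1, hC.isFirstEigenfunction hΩo hΩne hΩb, fun v hv => ?_⟩
    refine ae_eq_const_mul_indicator hΩo.measurableSet hv.1.1.measurable hv.1.1.ae_eq_zero hC.1.1 ?_
    filter_upwards [(isFirstEigenfunction_iff_levelSet hΩo hΩb hv.1.1 hv.1.2).1 hv] with t ht ht0
    exact measure_symmDiff_eq_zero_iff.1 (huniq _ (ht ht0))

end OneLaplace

theorem proposition2p1 (n : ℕ) (Ω : Set (EuclideanSpace ℝ (Fin n)))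
    (hΩ_open : IsOpen Ω) (hΩ_nonempty : Ω.Nonempty) (hΩ_bounded : Bornology.IsBounded Ω) :
    OneLaplace.cheegerConstant Ω = OneLaplace.lambdaOne Ω ∧
    (∀ u : EuclideanSpace ℝ (Fin n) → ℝ, OneLaplace.MemBV Ω u → ¬ u =ᵐ[volume] 0 →
      (OneLaplace.IsFirstEigenfunction Ω u ↔
        ∀ᵐ t : ℝ, volume (OneLaplace.levelSet Ω u t) ≠ 0 →
          OneLaplace.IsCheegerSet Ω (OneLaplace.levelSet Ω u t))) ∧
    ((∃ u : EuclideanSpace ℝ (Fin n) → ℝ, OneLaplace.IsFirstEigenfunction Ω u ∧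
        ∀ v : EuclideanSpace ℝ (Fin n) → ℝ, OneLaplace.IsFirstEigenfunction Ω v →
          ∃ c : ℝ, v =ᵐ[volume] fun x => c * u x) ↔
      (∃ C : Set (EuclideanSpace ℝ (Fin n)), OneLaplace.IsCheegerSet Ω C ∧
        ∀ D : Set (EuclideanSpace ℝ (Fin n)), OneLaplace.IsCheegerSet Ω D →
          volume (symmDiff D C) = 0)) :=
  ⟨OneLaplace.cheegerConstant_eq_lambdaOne hΩ_open hΩ_bounded,
    fun _ hu hu0 => OneLaplace.isFirstEigenfunction_iff_levelSet hΩ_open hΩ_bounded hu hu0,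
    OneLaplace.exists_unique_eigenfunction_iff hΩ_open hΩ_nonempty hΩ_bounded⟩
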